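/- Let $r>1$ be an integer. (a) For every real $\alpha\in(1,2r-1)$ and every $\varepsilon>0$ there is a finite connected simple graph $G$ with all vertex degrees in $\{2,\dots,2r\}$ such that $|\lambda_1(B_G)-\alpha|<\varepsilon$. Here $B_G$ is the non-backtracking matrix of $G$: its rows and columns are indexed by the oriented edges of $G$, and its entry at $(e,f)$ is $1$ if the head of $e$ is the tail of $f$ and $f$ is not the reversal of $e$, and $0$ otherwise. $\lambda_1(B_G)$ is its leading (Perron) eigenvalue, that is, the real eigenvalue that is at least the modulus of every complex eigenvalue of $B_G$. (b) Equivalently, the set of growth rates of strongly periodic trees with all degrees in $\{2,\dots,2r\}$ is a dense subset of the interval $[1,2r-1]$, i.e. its closure is $[1,2r-1]$. Here a tree $T$ is strongly periodic if it is the universal cover of a finite connected simple graph, and its growth rate is $\lim_{n\to\infty}|B_n(T)|^{1/n}=\lim_{n\to\infty}|S_n(T)|^{1/n}$, where $B_n(T)$ and $S_n(T)$ are the ball and the sphere of radius $n$ around a vertex of $T$ (both limits exist, are equal, and do not depend on the vertex). -/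

import Mathlib

open Filter Topology

/-- All vertex degrees of `G` lie in `{a, …, b}` (in particular they are finite). -/
def DegreesIn {V : Type*} (G : SimpleGraph V) (a b : ℕ) : Prop :=
  ∀ v : V, (a : ℕ∞) ≤ (G.neighborSet v).encard ∧ (G.neighborSet v).encard ≤ (b : ℕ∞)

/-- The non-backtracking (Hashimoto) matrix of a graph: rows and columns are indexed by the
oriented edges, and the entry at `(e, f)` is `1` if `f` starts where `e` ends and `f` is not the
reversal of `e`, and `0` otherwise. -/
def nonBacktrackingMatrix {V : Type*} [DecidableEq V] (G : SimpleGraph V) :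
    Matrix G.Dart G.Dart ℝ :=
  Matrix.of fun e f => if e.snd = f.fst ∧ f ≠ e.symm then 1 else 0

/-- `l` is the leading (Perron) eigenvalue of the square real matrix `M`: the real number `l` is an
eigenvalue of `M`, and every complex eigenvalue of `M` has modulus at most `l`. Such an `l` is
unique if it exists, and it is then the spectral radius of `M`. -/
def IsLeadingEigenvalue {ι : Type*} [Fintype ι] [DecidableEq ι] (M : Matrix ι ι ℝ) (l : ℝ) : Prop :=
  Module.End.HasEigenvalue (Matrix.toLin' M) l ∧
    ∀ z : ℂ, Module.End.HasEigenvalue (Matrix.toLin' (M.map (fun x : ℝ => (x : ℂ)))) z → ‖z‖ ≤ l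

/-- `f` is a covering map of graphs: a surjective homomorphism that maps the neighbours of each
vertex bijectively onto the neighbours of its image. -/
def IsGraphCovering {W V : Type*} {T : SimpleGraph W} {G : SimpleGraph V} (f : T →g G) : Prop :=
  Function.Surjective f ∧ ∀ w : W, Set.BijOn f (T.neighborSet w) (G.neighborSet (f w))

/-- `T` is the universal cover of the (connected) graph `G`: a tree that covers `G`. -/
def IsUniversalCover {W V : Type*} (T : SimpleGraph W) (G : SimpleGraph V) : Prop :=
  T.IsTree ∧ ∃ f : T →g G, IsGraphCovering f

/-- A tree is strongly periodic if it is the universal cover of a finite connected simple graph. -/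
def IsStronglyPeriodic {W : Type*} (T : SimpleGraph W) : Prop :=
  ∃ (V : Type) (_ : Finite V) (G : SimpleGraph V), G.Connected ∧ IsUniversalCover T G

/-- The sphere of radius `n` around `v` (meant for connected graphs). -/
def graphSphere {W : Type*} (T : SimpleGraph W) (v : W) (n : ℕ) : Set W :=
  {w | T.dist v w = n}

/-- The closed ball of radius `n` around `v` (meant for connected graphs). -/
def graphBall {W : Type*} (T : SimpleGraph W) (v : W) (n : ℕ) : Set W :=
  {w | T.dist v w ≤ n}

/-- `g` is the growth rate of `T`: from every base vertex, the `n`-th roots of the sizes of the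
balls of radius `n` and of the spheres of radius `n` both converge to `g`. -/
def HasGrowthRate {W : Type*} (T : SimpleGraph W) (g : ℝ) : Prop :=
  ∀ v : W,
    Tendsto (fun n : ℕ => ((graphBall T v n).ncard : ℝ) ^ (1 / (n : ℝ))) atTop (𝓝 g) ∧
    Tendsto (fun n : ℕ => ((graphSphere T v n).ncard : ℝ) ^ (1 / (n : ℝ))) atTop (𝓝 g)

/-- The set of growth rates of strongly periodic trees with all degrees in `{2, …, 2r}`. -/
def stronglyPeriodicGrowthRates (r : ℕ) : Set ℝ :=
  {g | ∃ (W : Type) (T : SimpleGraph W),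
    IsStronglyPeriodic T ∧ DegreesIn T 2 (2 * r) ∧ HasGrowthRate T g}

/-!
Let `B` be the non-backtracking matrix of `G`. If a positive function `U` on the vertices satisfies
`∑ U w = (l + (d v - 1) / l) U v` (sum over the neighbours `w` of `v`) and `U v < l U w` on edges,
then `x (v → w) = l U w - U v` is a positive eigenvector of `B` for `l` (`IsBassFunction.sum_sub`).
This one object serves both parts. By comparison with `x`, no eigenvalue of `B` exceeds `l` in
modulus (`isLeadingEigenvalue_of_pos`). On the universal cover, `x` multiplies by `l` from sphere to
sphere and takes finitely many positive values, so the spheres grow like `l ^ n`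
(`IsBassFunction.hasGrowthRate`). The universal cover is the tree of reduced walks
(`isUniversalCover_reducedWalkTree`). So it suffices to find such `G` and `U` with `l` close to a
given `α ∈ (1, 2r - 1)`; that growth rates lie in `[1, 2r - 1]` is a count of the neighbours in the
next sphere (`HasGrowthRate.mem_Icc`).

The graphs consist of levels `0, …, n`, with one edge from each vertex to each adjacent level and
`j i` edges inside level `i` (`levelGraph`; the levels are hypercubes, which gives simple graphs).
With `U` depending on the level only, an edge inside a level carries the fraction `1 / (1 + l)` of
the weight leaving a vertex, and if `t i` is the fraction on the edge from level `i` up, the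
equations are `j 0 / (1 + l) + t 0 = 1` and `j (i + 1) / (1 + l) + t (i + 1) = edgeShareInv l (t i)`.
For `l = α` these are the rules of a greedy expansion with digits `j` and remainders
`t i ∈ (0, 1 / (1 + α)]`, and `α < 2r - 1` bounds the digits so that all degrees are at most `2r`
(`IsExpansion`). Stopping the expansion at level `n` amounts to `t n = 0`. As `edgeShareInv α`
expands distances on the range of the remainders, the resulting value of `t 0` is off by an amount
tending to `0` as `n → ∞` (`IsExpansion.eventually_sub_tailShare_lt`). For fixed digits the shares
decrease in `l`, so a small change of `l` makes the equations hold exactly, by the intermediate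
value theorem (`exists_isLevelFunction_near`).
-/

/-! ### The recursion for the share of an edge -/

/-- In a positive eigenvector of the non-backtracking matrix for the eigenvalue `l`, an edge from
`v` to `w` carries this fraction of the total weight going out of `v`, where `S` is the fraction of
the total weight going out of `w` that is carried by all the other edges at `w`. -/
noncomputable def edgeShare (l S : ℝ) : ℝ := S / (l ^ 2 - (l ^ 2 - 1) * S)

/-- The inverse function of `edgeShare l`. -/
noncomputable def edgeShareInv (l t : ℝ) : ℝ := l ^ 2 * t / (1 + (l ^ 2 - 1) * t)

lemma edgeShare_den_pos {l S : ℝ} (hl : 1 ≤ l) (hS : S ≤ 1) : 0 < l ^ 2 - (l ^ 2 - 1) * S := by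
  have : 1 ≤ l ^ 2 := one_le_pow₀ hl
  nlinarith

lemma edgeShare_nonneg {l S : ℝ} (hl : 1 ≤ l) (h0 : 0 ≤ S) (hS : S ≤ 1) : 0 ≤ edgeShare l S :=
  div_nonneg h0 (edgeShare_den_pos hl hS).le

lemma edgeShare_pos {l S : ℝ} (hl : 1 ≤ l) (h0 : 0 < S) (hS : S ≤ 1) : 0 < edgeShare l S :=
  div_pos h0 (edgeShare_den_pos hl hS)

lemma edgeShare_lt_one_iff {l S : ℝ} (hl : 1 ≤ l) (hS : S ≤ 1) : edgeShare l S < 1 ↔ S < 1 := by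
  have : 1 ≤ l ^ 2 := one_le_pow₀ hl
  rw [edgeShare, div_lt_one (edgeShare_den_pos hl hS)]
  constructor <;> intro h <;> nlinarith

lemma edgeShare_mono {l S S' : ℝ} (hl : 1 ≤ l) (h : S ≤ S') (h' : S' ≤ 1) :
    edgeShare l S ≤ edgeShare l S' := by
  have : 1 ≤ l ^ 2 := one_le_pow₀ hl
  rw [edgeShare, edgeShare,
    div_le_div_iff₀ (edgeShare_den_pos hl (h.trans h')) (edgeShare_den_pos hl h')]
  nlinarith

lemma edgeShare_anti {b l S : ℝ} (hb : 1 ≤ b) (hl : b ≤ l) (h0 : 0 ≤ S) (h1 : S ≤ 1) :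
    edgeShare l S ≤ edgeShare b S := by
  have h : b ^ 2 ≤ l ^ 2 := by gcongr
  refine div_le_div_of_nonneg_left h0 (edgeShare_den_pos hb h1) ?_
  nlinarith

lemma edgeShare_edgeShareInv {l t : ℝ} (hl : 1 ≤ l) (ht : 0 ≤ t) :
    edgeShare l (edgeShareInv l t) = t := by
  have h1 : 1 ≤ l ^ 2 := one_le_pow₀ hl
  have hD : 0 < 1 + (l ^ 2 - 1) * t := by nlinarith
  have h2 : l ^ 2 - (l ^ 2 - 1) * edgeShareInv l t = l ^ 2 / (1 + (l ^ 2 - 1) * t) := by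
    rw [edgeShareInv]; field_simp; ring
  rw [edgeShare, h2, edgeShareInv, div_div_div_cancel_right₀ hD.ne']
  field_simp

lemma edgeShareInv_edgeShare {l S : ℝ} (hl : 1 ≤ l) (hS : S ≤ 1) :
    edgeShareInv l (edgeShare l S) = S := by
  have hD := edgeShare_den_pos hl hS
  have h2 : 1 + (l ^ 2 - 1) * edgeShare l S = l ^ 2 / (l ^ 2 - (l ^ 2 - 1) * S) := by
    rw [edgeShare]; field_simp; ring
  have : l ≠ 0 := by positivity
  rw [edgeShareInv, h2, edgeShare, ← mul_div_assoc, div_div_div_cancel_right₀ hD.ne']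
  field_simp

/-- With digits `j`, the share of the edge from level `i` to level `i + 1` of a path of levels that
stops at level `i + n`, if every vertex on level `k` has `j k` further edges, each of them of share
`1 / (1 + l)`. The truncation at `1` makes this continuous in `l`; it is inactive in
the solution that is used. -/
noncomputable def tailShare (j : ℕ → ℕ) (l : ℝ) : ℕ → ℕ → ℝ
  | 0, _ => 0
  | n + 1, i => edgeShare l (min 1 (j (i + 1) / (1 + l) + tailShare j l n (i + 1)))

lemma tailShare_nonneg (j : ℕ → ℕ) {l : ℝ} (hl : 1 ≤ l) (n i : ℕ) : 0 ≤ tailShare j l n i := by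
  induction n generalizing i with
  | zero => simp [tailShare]
  | succ n ih =>
    refine edgeShare_nonneg hl (le_min zero_le_one ?_) (min_le_left _ _)
    have := ih (i + 1)
    positivity

lemma tailShare_pos (j : ℕ → ℕ) {l : ℝ} (hl : 1 ≤ l) (n i : ℕ) (h : 1 ≤ j (i + n + 1)) :
    0 < tailShare j l (n + 1) i := by
  induction n generalizing i with
  | zero =>
    have : (1 : ℝ) ≤ j (i + 1) := by exact_mod_cast h
    exact edgeShare_pos hl (lt_min one_pos (by simp only [tailShare]; positivity)) (min_le_left _ _)
  | succ n ih =>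
    have := ih (i + 1) (by convert h using 2; ring)
    rw [tailShare]
    exact edgeShare_pos hl (lt_min one_pos (by positivity)) (min_le_left _ _)

lemma tailShare_anti (j : ℕ → ℕ) {b l : ℝ} (hb : 1 ≤ b) (hl : b ≤ l) (n i : ℕ) :
    tailShare j l n i ≤ tailShare j b n i := by
  induction n generalizing i with
  | zero => simp [tailShare]
  | succ n ih =>
    have h := ih (i + 1)
    have h0 := tailShare_nonneg j (hb.trans hl) n (i + 1)
    have hl0 : 0 ≤ l := by linarith
    rw [tailShare, tailShare]
    refine (edgeShare_anti hb hl (le_min zero_le_one (by positivity)) (min_le_left _ _)).trans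
      (edgeShare_mono hb (min_le_min_left _ ?_) (min_le_left _ _))
    gcongr

lemma continuousOn_tailShare (j : ℕ → ℕ) (n i : ℕ) :
    ContinuousOn (fun l => tailShare j l n i) (Set.Ici 1) := by
  induction n generalizing i with
  | zero => simpa [tailShare] using continuousOn_const
  | succ n ih =>
    have h1 : ContinuousOn (fun l : ℝ => (j (i + 1) : ℝ) / (1 + l)) (Set.Ici 1) := by
      refine continuousOn_const.div (by fun_prop) fun l hl => ?_
      have : (1 : ℝ) ≤ l := hl
      exact (by linarith : (0 : ℝ) < 1 + l).ne'
    have h2 : ContinuousOn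
        (fun l : ℝ => min 1 ((j (i + 1) : ℝ) / (1 + l) + tailShare j l n (i + 1))) (Set.Ici 1) :=
      continuousOn_const.inf (h1.add (ih (i + 1)))
    simp only [tailShare, edgeShare]
    refine h2.div (by fun_prop) fun l hl => ?_
    exact (edgeShare_den_pos hl (min_le_left _ _)).ne'

/-! ### The expansion of a number `a` -/

/-- `j` and `t` are the digits and the remainders of the expansion of `1` with respect to the
expanding map `edgeShareInv a` and the unit `1 / (1 + a)`. Remainders lie in `(0, 1 / (1 + a)]`, so
that none of them vanishes. -/
structure IsExpansion (a : ℝ) (j : ℕ → ℕ) (t : ℕ → ℝ) : Prop where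
  zero : j 0 / (1 + a) + t 0 = 1
  succ : ∀ i, j (i + 1) / (1 + a) + t (i + 1) = edgeShareInv a (t i)
  pos : ∀ i, 0 < t i
  le : ∀ i, t i ≤ 1 / (1 + a)

lemma exists_nat_mul_add {q y : ℝ} (hq : 0 < q) (hy : 0 < y) :
    ∃ p : ℕ × ℝ, p.1 * q + p.2 = y ∧ 0 < p.2 ∧ p.2 ≤ q := by
  have h0 : 0 < ⌈y / q⌉₊ := Nat.ceil_pos.2 (by positivity)
  obtain ⟨k, hk⟩ := Nat.exists_eq_succ_of_ne_zero h0.ne'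
  have h1 : y / q ≤ k + 1 := by
    have := Nat.le_ceil (y / q); rw [hk] at this; exact_mod_cast this
  have h2 : (k : ℝ) < y / q := Nat.lt_ceil.1 (by omega)
  rw [div_le_iff₀ hq] at h1
  rw [lt_div_iff₀ hq] at h2
  exact ⟨(k, y - k * q), by ring, by simpa using h2, by simp only; linarith⟩

lemma edgeShareInv_pos {a t : ℝ} (ha : 1 < a) (ht : 0 < t) : 0 < edgeShareInv a t := by
  have h1 : 1 < a ^ 2 := one_lt_pow₀ ha two_ne_zero
  have hD : 0 < 1 + (a ^ 2 - 1) * t := by nlinarith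
  unfold edgeShareInv; positivity

lemma exists_isExpansion {a : ℝ} (ha : 1 < a) : ∃ j t, IsExpansion a j t := by
  have hq : 0 < 1 / (1 + a) := by positivity
  choose! p hp h0 h1 using fun y => exists_nat_mul_add (y := y) hq
  let s : ℕ → ℕ × ℝ := fun n => Nat.rec (p 1) (fun _ x => p (edgeShareInv a x.2)) n
  have hs : ∀ i, s (i + 1) = p (edgeShareInv a (s i).2) := fun i => rfl
  have hpos : ∀ i, 0 < (s i).2 := by
    intro i
    induction i with
    | zero => exact h0 1 one_pos
    | succ i ih => rw [hs]; exact h0 _ (edgeShareInv_pos ha ih)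
  refine ⟨fun i => (s i).1, fun i => (s i).2, ?_, fun i => ?_, hpos, fun i => ?_⟩
  · rw [div_eq_mul_one_div]; exact hp 1 one_pos
  · rw [div_eq_mul_one_div, hs]; exact hp _ (edgeShareInv_pos ha (hpos i))
  · cases i with
    | zero => exact h1 1 one_pos
    | succ i => rw [hs]; exact h1 _ (edgeShareInv_pos ha (hpos i))

namespace IsExpansion

variable {a : ℝ} {j : ℕ → ℕ} {t : ℕ → ℝ}

lemma den_le (h : IsExpansion a j t) (ha : 1 < a) (i : ℕ) : 1 + (a ^ 2 - 1) * t i ≤ a := by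
  have h1 := h.le i
  rw [le_div_iff₀ (by positivity)] at h1
  nlinarith

lemma edgeShareInv_le (h : IsExpansion a j t) (ha : 1 < a) (i : ℕ) :
    edgeShareInv a (t i) ≤ a / (1 + a) := by
  have h1 := h.le i
  have h2 : 1 < a ^ 2 := one_lt_pow₀ ha two_ne_zero
  have h3 := h.pos i
  rw [le_div_iff₀ (by positivity)] at h1
  rw [edgeShareInv, div_le_div_iff₀ (by nlinarith) (by positivity)]
  nlinarith [mul_pos (by linarith : 0 < a) h3]

lemma mul_le_edgeShareInv (h : IsExpansion a j t) (ha : 1 < a) (i : ℕ) :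
    a * t i ≤ edgeShareInv a (t i) := by
  have h1 := h.den_le ha i
  have h2 : 1 < a ^ 2 := one_lt_pow₀ ha two_ne_zero
  have h3 := h.pos i
  rw [edgeShareInv, le_div_iff₀ (by nlinarith)]
  have : 0 < a * t i := by positivity
  nlinarith

lemma digit_zero_lt (h : IsExpansion a j t) (ha : 1 < a) : (j 0 : ℝ) < 1 + a := by
  have h0 := h.zero
  have h1 := h.pos 0
  rw [← div_lt_one (by positivity)]
  linarith

lemma le_digit_zero (h : IsExpansion a j t) (ha : 1 < a) : a ≤ j 0 := by
  have h0 := h.zero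
  have h1 := h.le 0
  have h2 : (1 : ℝ) ≤ (j 0 + 1) / (1 + a) := by rw [add_div]; linarith
  rw [one_le_div (by positivity)] at h2
  linarith

lemma digit_succ_lt (h : IsExpansion a j t) (ha : 1 < a) (i : ℕ) : (j (i + 1) : ℝ) < a := by
  have h0 := h.succ i
  have h1 := h.pos (i + 1)
  have h2 := h.edgeShareInv_le ha i
  rw [← div_lt_div_iff_of_pos_right (by positivity : 0 < 1 + a)]
  linarith

/-- As long as the digits vanish, the remainders grow geometrically. -/
lemma exists_digit_pos (h : IsExpansion a j t) (ha : 1 < a) (n : ℕ) : ∃ m, n ≤ m ∧ 1 ≤ j m := by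
  by_contra! hc
  have hj : ∀ m, n ≤ m → j m = 0 := fun m hm => by have := hc m hm; omega
  have hg : ∀ k, a ^ k * t n ≤ t (n + k) := by
    intro k
    induction k with
    | zero => simp
    | succ k ih =>
      have h1 := h.succ (n + k)
      rw [hj _ (by omega)] at h1
      have h2 := h.mul_le_edgeShareInv ha (n + k)
      simp only [Nat.cast_zero, zero_div, zero_add] at h1
      rw [← add_assoc, h1, pow_succ']
      nlinarith
  obtain ⟨k, hk⟩ := pow_unbounded_of_one_lt (1 / t n) ha
  rw [div_lt_iff₀ (h.pos n)] at hk
  have h1 := h.le (n + k)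
  have h2 : 1 / (1 + a) < 1 := by rw [div_lt_one (by positivity)]; linarith
  linarith [hg k]

lemma tailShare_le (h : IsExpansion a j t) (ha : 1 < a) (n i : ℕ) : tailShare j a n i ≤ t i := by
  induction n generalizing i with
  | zero => exact (h.pos i).le
  | succ n ih =>
    have h1 := h.succ i
    have h2 : edgeShareInv a (t i) ≤ 1 :=
      (h.edgeShareInv_le ha i).trans (by rw [div_le_one (by positivity)]; linarith)
    rw [tailShare, ← edgeShare_edgeShareInv ha.le (h.pos i).le, ← h1]
    rw [← h1] at h2
    refine edgeShare_mono ha.le ((min_le_right _ _).trans ?_) h2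
    linarith [ih (i + 1)]

/-- An error of at least `δ` in a remainder is expanded by a factor bounded away from `1`. The map
`edgeShareInv a` is concave with derivative exactly `1` at the end `1 / (1 + a)` of the range of the
remainders, but the truncated remainder stays at distance at least `δ` below this point. -/
lemma error_expansion (h : IsExpansion a j t) (ha : 1 < a) {δ : ℝ} (hδ : 0 < δ) (n : ℕ) :
    ∀ i d, δ ≤ d → d ≤ t i - tailShare j a n i →
      (1 + (a ^ 2 - 1) * δ / a) ^ n * d ≤ 1 / (1 + a) := by
  have h2 : 1 < a ^ 2 := one_lt_pow₀ ha two_ne_zero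
  have hK : 1 ≤ 1 + (a ^ 2 - 1) * δ / a := by
    have : 0 ≤ (a ^ 2 - 1) * δ / a := div_nonneg (by nlinarith) (by linarith)
    linarith
  induction n with
  | zero =>
    intro i d _ hd
    simp only [tailShare, sub_zero] at hd
    simpa using hd.trans (h.le i)
  | succ n ih =>
    intro i d hδd hd
    have h0 := h.pos i
    have hS1 : j (i + 1) / (1 + a) + tailShare j a n (i + 1) ≤ 1 := by
      have h4 := h.tailShare_le ha n (i + 1)
      have h5 := h.edgeShareInv_le ha i
      have h6 := h.succ i
      have h7 : a / (1 + a) ≤ 1 := by rw [div_le_one (by positivity)]; linarith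
      linarith
    set s := tailShare j a (n + 1) i with hs
    have hs0 : 0 ≤ s := tailShare_nonneg j ha.le _ _
    have hsS : edgeShareInv a s = j (i + 1) / (1 + a) + tailShare j a n (i + 1) := by
      rw [hs, tailShare, min_eq_right hS1, edgeShareInv_edgeShare ha.le hS1]
    have hT := h.succ i
    have hkey : (1 + (a ^ 2 - 1) * δ / a) * d ≤ edgeShareInv a (t i) - edgeShareInv a s := by
      have hA := h.den_le ha i
      have hApos : 0 < 1 + (a ^ 2 - 1) * t i := by nlinarith
      have hBpos : 0 < 1 + (a ^ 2 - 1) * s := by nlinarith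
      have hB : 1 + (a ^ 2 - 1) * s ≤ a - (a ^ 2 - 1) * δ := by nlinarith
      have hdiff : edgeShareInv a (t i) - edgeShareInv a s =
          a ^ 2 * (t i - s) / ((1 + (a ^ 2 - 1) * t i) * (1 + (a ^ 2 - 1) * s)) := by
        rw [edgeShareInv, edgeShareInv, div_sub_div _ _ hApos.ne' hBpos.ne']; congr 1; ring
      have hprod : (1 + (a ^ 2 - 1) * t i) * (1 + (a ^ 2 - 1) * s) ≤
          a * (a - (a ^ 2 - 1) * δ) := by gcongr
      rw [hdiff, le_div_iff₀ (by positivity)]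
      have hd0 : 0 < d := hδ.trans_le hδd
      have hx : (1 + (a ^ 2 - 1) * δ / a) * (a * (a - (a ^ 2 - 1) * δ)) ≤ a ^ 2 := by
        have : (1 + (a ^ 2 - 1) * δ / a) * (a * (a - (a ^ 2 - 1) * δ)) =
            a ^ 2 - ((a ^ 2 - 1) * δ) ^ 2 := by field_simp; ring
        rw [this]; nlinarith [sq_nonneg ((a ^ 2 - 1) * δ)]
      calc (1 + (a ^ 2 - 1) * δ / a) * d * ((1 + (a ^ 2 - 1) * t i) * (1 + (a ^ 2 - 1) * s))
          ≤ (1 + (a ^ 2 - 1) * δ / a) * d * (a * (a - (a ^ 2 - 1) * δ)) := by gcongr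
        _ = ((1 + (a ^ 2 - 1) * δ / a) * (a * (a - (a ^ 2 - 1) * δ))) * d := by ring
        _ ≤ a ^ 2 * d := by gcongr
        _ ≤ a ^ 2 * (t i - s) := by gcongr
    have hd0 : 0 < d := hδ.trans_le hδd
    rw [pow_succ, mul_assoc]
    refine ih (i + 1) _ ?_ (by linarith)
    nlinarith

lemma eventually_sub_tailShare_lt (h : IsExpansion a j t) (ha : 1 < a) {δ : ℝ} (hδ : 0 < δ) :
    ∀ᶠ n in atTop, t 0 - tailShare j a n 0 < δ := by
  have h2 : 1 < a ^ 2 := one_lt_pow₀ ha two_ne_zero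
  have hK : 1 < 1 + (a ^ 2 - 1) * δ / a := by
    have : 0 < (a ^ 2 - 1) * δ / a := div_pos (by nlinarith) (by linarith)
    linarith
  filter_upwards [(tendsto_pow_atTop_atTop_of_one_lt hK).eventually_gt_atTop (1 / (1 + a) / δ)]
    with n hn
  by_contra! hc
  have := h.error_expansion ha hδ n 0 δ le_rfl hc
  rw [div_lt_iff₀ hδ] at hn
  linarith

end IsExpansion

/-! ### Level functions -/

/-- A positive function `U` on levels `0, …, n`, for the number `l` and the digits `j`: the
equations say that `∑ U w = (l + (d - 1) / l) U v`, the sum being over the neighbours `w` of `v`, on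
a graph where a vertex `v` on level `i` has `d` neighbours, namely one on each adjacent level and
`j i` on its own level. -/
structure IsLevelFunction (l : ℝ) (n : ℕ) (j : ℕ → ℕ) (U : ℕ → ℝ) : Prop where
  pos : ∀ i, 0 < U i
  first : U 1 + j 0 * U 0 = (l + j 0 / l) * U 0
  mid : ∀ i, i + 1 < n → U i + U (i + 2) + j (i + 1) * U (i + 1) =
    (l + (j (i + 1) + 1) / l) * U (i + 1)
  last : ∀ i, i + 1 = n → U i + j n * U n = (l + j n / l) * U n
  lt_up : ∀ i < n, U i < l * U (i + 1)
  lt_down : ∀ i < n, U (i + 1) < l * U i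

lemma exists_isLevelFunction {l : ℝ} (hl : 1 < l) {n : ℕ} {j : ℕ → ℕ} (hn : 0 < n)
    (hj0 : 1 ≤ j 0) (hj : 1 ≤ j n) (h : j 0 / (1 + l) + tailShare j l n 0 = 1) :
    ∃ U, IsLevelFunction l n j U := by
  have hl2 : 1 < l ^ 2 := one_lt_pow₀ hl two_ne_zero
  set τ : ℕ → ℝ := fun i => tailShare j l (n - i) i with hτ
  have hτn : τ n = 0 := by simp [hτ, tailShare]
  have hτ0 : ∀ i < n, 0 < τ i := by
    intro i hi
    have := tailShare_pos j hl.le (n - i - 1) i (by convert hj using 2; omega)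
    convert this using 2; omega
  have hτs : ∀ i < n, τ i = edgeShare l (min 1 (j (i + 1) / (1 + l) + τ (i + 1))) := by
    intro i hi
    have h1 : n - i = n - (i + 1) + 1 := by omega
    simp only [hτ]
    rw [h1, tailShare]
  -- the truncation at `1` would propagate down to level `0`, where it contradicts `1 ≤ j 0`
  have hτ1 : ∀ i < n, τ i < 1 := by
    intro i
    induction i with
    | zero =>
      intro _
      have h1 : (1 : ℝ) ≤ j 0 := by exact_mod_cast hj0
      have h2 : 0 < (j 0 : ℝ) / (1 + l) := by positivity
      simp only [hτ, Nat.sub_zero]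
      linarith
    | succ i ih =>
      intro hi
      have h1 := ih (by omega)
      rw [hτs i (by omega), edgeShare_lt_one_iff hl.le (min_le_left _ _), min_lt_iff] at h1
      have h2 : (0 : ℝ) ≤ j (i + 1) / (1 + l) := by positivity
      rcases h1 with h1 | h1
      · exact absurd h1 (lt_irrefl _)
      · linarith
  have hτi : ∀ i < n, τ i = edgeShare l (j (i + 1) / (1 + l) + τ (i + 1)) ∧
      j (i + 1) / (1 + l) + τ (i + 1) < 1 := by
    intro i hi
    have h1 := hτ1 i hi
    rw [hτs i hi, edgeShare_lt_one_iff hl.le (min_le_left _ _), min_lt_iff] at h1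
    have h2 := h1.resolve_left (lt_irrefl _)
    exact ⟨by rw [hτs i hi, min_eq_right h2.le], h2⟩
  -- the ratios of consecutive values of the level function; the absolute value only matters
  -- beyond level `n`, where it keeps them positive
  set R : ℕ → ℝ := fun i => (1 + (l ^ 2 - 1) * |τ i|) / l with hR
  have hRpos : ∀ i, 0 < R i := fun i => by
    have := mul_nonneg (by linarith : 0 ≤ l ^ 2 - 1) (abs_nonneg (τ i))
    simp only [hR]; positivity
  have hRτ : ∀ i ≤ n, l * R i = 1 + (l ^ 2 - 1) * τ i := by
    intro i hi
    have : |τ i| = τ i := by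
      rcases hi.lt_or_eq with h1 | h1
      · exact abs_of_pos (hτ0 i h1)
      · rw [h1, hτn, abs_zero]
    simp only [hR, this]; field_simp
  have hrec : ∀ i < n, 1 + R (i + 1) * R i + j (i + 1) * R i =
      (l + (j (i + 1) + 1) / l) * R i := by
    intro i hi
    obtain ⟨h1, h2⟩ := hτi i hi
    have hD := edgeShare_den_pos hl.le h2.le
    set S := (j (i + 1) : ℝ) / (1 + l) + τ (i + 1) with hS
    have h3 : R i * (l ^ 2 - (l ^ 2 - 1) * S) = l := by
      have h4 := hRτ i hi.le
      have h5 : 1 + (l ^ 2 - 1) * edgeShare l S = l ^ 2 / (l ^ 2 - (l ^ 2 - 1) * S) := by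
        rw [edgeShare]; field_simp; ring
      rw [h1, h5, eq_div_iff hD.ne'] at h4
      have hl0 : l ≠ 0 := by positivity
      apply mul_left_cancel₀ hl0
      linarith
    have h6 : (l ^ 2 - 1) * S = (l - 1) * j (i + 1) + (l * R (i + 1) - 1) := by
      rw [hRτ (i + 1) hi, hS]; field_simp; ring
    rw [h6] at h3
    have hl0 : l ≠ 0 := by positivity
    field_simp
    linarith
  have hR0 : R 0 + j 0 = l + j 0 / l := by
    have h1 := hRτ 0 (by omega)
    have h2 : τ 0 = 1 - j 0 / (1 + l) := by simp only [hτ, Nat.sub_zero]; linarith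
    have h3 : (l ^ 2 - 1) * τ 0 = l ^ 2 - 1 - (l - 1) * j 0 := by rw [h2]; field_simp; ring
    have hl0 : l ≠ 0 := by positivity
    field_simp
    linarith
  have hRn : l * R n = 1 := by rw [hRτ n le_rfl, hτn]; ring
  refine ⟨fun i => ∏ k ∈ Finset.range i, R k, fun i => Finset.prod_pos fun k _ => hRpos k, ?_,
    fun i hi => ?_, fun i hi => ?_, fun i hi => ?_, fun i hi => ?_⟩
  · simpa using hR0
  · have h1 := hrec i (by omega)
    simp only [Finset.prod_range_succ]
    linear_combination (∏ k ∈ Finset.range i, R k) * h1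
  · subst hi
    have h1 := hrec i (by omega)
    simp only [Finset.prod_range_succ]
    have hl0 : l ≠ 0 := by positivity
    have h2 : R (i + 1) = 1 / l := by rw [eq_div_iff hl0]; linarith
    rw [h2] at h1
    rw [add_div] at h1
    linear_combination (∏ k ∈ Finset.range i, R k) * h1
  · have h1 : 0 < ∏ k ∈ Finset.range i, R k := Finset.prod_pos fun k _ => hRpos k
    have h2 := hRτ i hi.le
    have h3 := mul_pos (by linarith : 0 < l ^ 2 - 1) (hτ0 i hi)
    simp only [Finset.prod_range_succ]
    nlinarith
  · have h1 : 0 < ∏ k ∈ Finset.range i, R k := Finset.prod_pos fun k _ => hRpos k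
    have h2 := hRτ i hi.le
    have h3 := hτ1 i hi
    simp only [Finset.prod_range_succ]
    rw [mul_comm l]
    gcongr
    have : l * R i < l * l := by nlinarith
    exact lt_of_mul_lt_mul_left this (by linarith)

/-- Every number `α > 1` is approximated by numbers `l` that admit a level function whose digits
are bounded in terms of `α`. -/
lemma exists_isLevelFunction_near {α ε : ℝ} (hα : 1 < α) (hε : 0 < ε) :
    ∃ (l : ℝ) (n : ℕ) (j : ℕ → ℕ) (U : ℕ → ℝ), 1 < l ∧ |l - α| < ε ∧ 0 < n ∧
      IsLevelFunction l n j U ∧ 1 ≤ j n ∧ 2 ≤ j 0 ∧ (j 0 : ℝ) < 1 + α ∧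
      ∀ i, j (i + 1) < j 0 := by
  obtain ⟨j, t, h⟩ := exists_isExpansion hα
  have hj0 := h.le_digit_zero hα
  have hj02 : 2 ≤ j 0 := by
    have : (1 : ℝ) < j 0 := hα.trans_le hj0
    exact_mod_cast this
  obtain ⟨b, hb1, hb2⟩ := exists_between (max_lt hα (sub_lt_self α hε))
  obtain ⟨hb1, hbε⟩ := max_lt_iff.1 hb1
  -- lowering `l` from `α` to `b` raises the share of each of the `j 0 ≥ 1` unit edges by `δ`
  set δ : ℝ := 1 / (1 + b) - 1 / (1 + α) with hδ
  have hδ0 : 0 < δ := by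
    have : 1 / (1 + α) < 1 / (1 + b) := by gcongr
    linarith
  obtain ⟨N, hN⟩ := eventually_atTop.1 (h.eventually_sub_tailShare_lt hα hδ0)
  obtain ⟨n, hn, hjn⟩ := h.exists_digit_pos hα (N + 1)
  have hNn := hN n (by omega)
  let D : ℝ → ℝ := fun l => j 0 / (1 + l) + tailShare j l n 0
  have hD : ContinuousOn D (Set.Icc b α) := by
    refine ContinuousOn.add (continuousOn_const.div (by fun_prop) fun l hl => ?_)
      ((continuousOn_tailShare j n 0).mono fun l hl => hb1.le.trans hl.1)
    have := hl.1
    exact (by linarith : (0 : ℝ) < 1 + l).ne'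
  have hDα : D α ≤ 1 := by
    have h1 := h.zero
    have h2 := h.tailShare_le hα n 0
    simp only [D]; linarith
  have hDb : 1 ≤ D b := by
    have h1 := h.zero
    have h2 := tailShare_anti j hb1.le hb2.le n 0
    have h3 : δ ≤ j 0 * δ := by
      have : (1 : ℝ) ≤ j 0 := by linarith
      nlinarith
    have h4 : (j 0 : ℝ) / (1 + b) = j 0 / (1 + α) + j 0 * δ := by rw [hδ]; ring
    simp only [D]; linarith
  obtain ⟨l, hl, hl1⟩ := intermediate_value_Icc' hb2.le hD ⟨hDα, hDb⟩
  obtain ⟨U, hU⟩ := exists_isLevelFunction (hb1.trans_le hl.1) (by omega) (by omega) hjn hl1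
  refine ⟨l, n, j, U, hb1.trans_le hl.1, ?_, by omega, hU, hjn, hj02, h.digit_zero_lt hα,
    fun i => ?_⟩
  · rw [abs_lt]; constructor <;> linarith [hl.1, hl.2]
  · have := (h.digit_succ_lt hα i).trans_le hj0
    exact_mod_cast this

/-! ### Level graphs -/

/-- On the hypercube `Fin K → ZMod 2`, the edges in the first `d` directions. -/
def flipGraph (K d : ℕ) : SimpleGraph (Fin K → ZMod 2) where
  Adj s s' := ∃ k : Fin K, (k : ℕ) < d ∧ s' = s + Pi.single k 1
  symm := ⟨by
    rintro s _ ⟨k, hk, rfl⟩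
    exact ⟨k, hk, funext fun i => by simp [add_assoc, CharTwo.add_self_eq_zero]⟩⟩
  loopless := ⟨by
    rintro s ⟨k, -, h⟩
    have := congrFun (left_eq_add.1 h) k
    simp at this⟩

open Classical in
lemma card_flipGraph {K d : ℕ} (h : d ≤ K) (s : Fin K → ZMod 2) :
    ({s' | (flipGraph K d).Adj s s'} : Finset (Fin K → ZMod 2)).card = d := by
  have h1 : ({s' | (flipGraph K d).Adj s s'} : Finset (Fin K → ZMod 2)) =
      (Finset.univ.filter fun k : Fin K => (k : ℕ) < d).image fun k => s + Pi.single k 1 := by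
    ext s'
    rw [Finset.mem_filter_univ]
    simp [flipGraph, eq_comm]
  rw [h1, Finset.card_image_of_injective, Fin.card_filter_val_lt, min_eq_right h]
  intro k k' hk
  by_contra hne
  simpa [hne] using congrFun (add_left_cancel hk) k

lemma flipGraph_self_reachable (K : ℕ) (s u : Fin K → ZMod 2) :
    (flipGraph K K).Reachable s (s + u) := by
  have key : ∀ A : Finset (Fin K), (flipGraph K K).Reachable s (s + ∑ k ∈ A, Pi.single k (u k)) := by
    intro A
    induction A using Finset.induction_on with
    | empty => simp
    | insert k A hk ih =>
      rw [Finset.sum_insert hk, add_comm, add_comm _ (∑ k ∈ A, _), add_comm, ← add_assoc]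
      rcases ((by decide : ∀ z : ZMod 2, z = 0 ∨ z = 1) (u k)) with h | h
      · simpa [h] using ih
      · rw [h]
        exact ih.trans (SimpleGraph.Adj.reachable ⟨k, k.2, rfl⟩)
  simpa [Finset.univ_sum_single] using key Finset.univ

/-- The graph with levels `0, …, n`, each of them a copy of the hypercube `(ZMod 2) ^ K`. Level `i`
carries the edges of the hypercube in the first `j i` directions, and each vertex is joined to its
copies on the adjacent levels. -/
def levelGraph (n K : ℕ) (j : ℕ → ℕ) : SimpleGraph (Fin (n + 1) × (Fin K → ZMod 2)) where
  Adj v w := (v.1 = w.1 ∧ (flipGraph K (j v.1)).Adj v.2 w.2) ∨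
    (v.2 = w.2 ∧ ((w.1 : ℕ) = v.1 + 1 ∨ (v.1 : ℕ) = w.1 + 1))
  symm := ⟨by
    rintro ⟨i, s⟩ ⟨i', s'⟩ (⟨h, h'⟩ | ⟨h, h'⟩)
    · simp only at h h' ⊢; subst h; exact Or.inl ⟨rfl, h'.symm⟩
    · exact Or.inr ⟨h.symm, h'.symm⟩⟩
  loopless := ⟨by
    rintro ⟨i, s⟩ (⟨-, h⟩ | ⟨-, h⟩)
    · exact h.ne rfl
    · simp at h⟩

lemma levelGraph_connected (n K : ℕ) (j : ℕ → ℕ) (hj : j 0 = K) :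
    (levelGraph n K j).Connected := by
  have h0 : ∀ s s' : Fin K → ZMod 2, (levelGraph n K j).Reachable (0, s) (0, s') := by
    intro s s'
    let f : flipGraph K K →g levelGraph n K j :=
      { toFun := fun s => (0, s), map_rel' := fun h => Or.inl ⟨rfl, by simpa [hj] using h⟩ }
    have := (flipGraph_self_reachable K s (s' - s)).map f
    rwa [add_sub_cancel] at this
  have h1 : ∀ (i : ℕ) (hi : i < n + 1) (s : Fin K → ZMod 2),
      (levelGraph n K j).Reachable (⟨i, hi⟩, s) (0, s) := by
    intro i
    induction i with
    | zero => intro _ _; rfl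
    | succ i ih =>
      intro hi s
      refine SimpleGraph.Reachable.trans (SimpleGraph.Adj.reachable ?_) (ih (by omega) s)
      exact Or.inr ⟨rfl, Or.inr rfl⟩
  have : Nonempty (Fin (n + 1) × (Fin K → ZMod 2)) := ⟨(0, 0)⟩
  refine ⟨fun v w => ?_⟩
  exact ((h1 v.1 v.1.2 v.2).trans (h0 v.2 w.2)).trans (h1 w.1 w.1.2 w.2).symm

open Classical in
lemma sum_neighbor_levelGraph (n K : ℕ) (j : ℕ → ℕ) (hj : ∀ i, j i ≤ K) (g : ℕ → ℝ)
    (v : Fin (n + 1) × (Fin K → ZMod 2)) :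
    ∑ w ∈ (levelGraph n K j).neighborFinset v, g w.1 =
      (if (v.1 : ℕ) < n then g (v.1 + 1) else 0) + (if 0 < (v.1 : ℕ) then g (v.1 - 1) else 0) +
        j v.1 * g v.1 := by
  obtain ⟨i, s⟩ := v
  have h1 : ∀ w : Fin (n + 1) × (Fin K → ZMod 2),
      (if (levelGraph n K j).Adj (i, s) w then g w.1 else 0) =
        (if s = w.2 then (if (w.1 : ℕ) = i + 1 then g (i + 1) else 0) else 0) +
        (if s = w.2 then (if (i : ℕ) = w.1 + 1 then g (i - 1) else 0) else 0) +
        (if i = w.1 then (if (flipGraph K (j i)).Adj s w.2 then g i else 0) else 0) := by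
    rintro ⟨i', s'⟩
    simp only [levelGraph]
    by_cases hi : i = i'
    · subst hi; simp
    · by_cases hs : s = s'
      · subst hs
        by_cases h2 : (i' : ℕ) = i + 1
        · have h3 : ¬ (i : ℕ) = i' + 1 := by omega
          simp [hi, h2]; omega
        · by_cases h3 : (i : ℕ) = i' + 1
          · simp only [hi, h3, false_and, Nat.add_sub_cancel]
            have h4 : ¬ (i' : ℕ) = i' + 1 + 1 := by omega
            simp [h4]
          · simp [hi, h2, h3]
      · simp [hi, hs]
  rw [SimpleGraph.neighborFinset_eq_filter, Finset.sum_filter, Finset.sum_congr rfl fun w _ => h1 w,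
    Finset.sum_add_distrib, Finset.sum_add_distrib]
  congr 1
  · congr 1
    · rw [Fintype.sum_prod_type]
      simp only [Finset.sum_ite_eq, Finset.mem_univ, if_true]
      by_cases hi : (i : ℕ) < n
      · rw [Finset.sum_eq_single ⟨i + 1, by omega⟩]
        · simp [hi]
        · intro b _ hb
          rw [if_neg]; intro h; exact hb (Fin.ext h)
        · simp
      · rw [if_neg hi]
        refine Finset.sum_eq_zero fun b _ => if_neg ?_
        have := b.2
        omega
    · rw [Fintype.sum_prod_type]
      simp only [Finset.sum_ite_eq, Finset.mem_univ, if_true]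
      by_cases hi : 0 < (i : ℕ)
      · rw [Finset.sum_eq_single ⟨i - 1, by omega⟩]
        · simp only [hi, if_true]
          rw [if_pos (by omega)]
        · intro b _ hb
          rw [if_neg]; intro h; exact hb (Fin.ext (by simp only; omega))
        · simp
      · rw [if_neg hi]
        exact Finset.sum_eq_zero fun b _ => if_neg (by omega)
  · rw [Fintype.sum_prod_type_right]
    simp only [Finset.sum_ite_eq, Finset.mem_univ, if_true]
    rw [← Finset.sum_filter, Finset.sum_const, card_flipGraph (hj i), nsmul_eq_mul]

/-- A positive function on the vertices that gives rise, by `v → w ↦ l * U w - U v`, to a positive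
eigenvector of the non-backtracking matrix for the eigenvalue `l`. -/
structure IsBassFunction {V : Type*} (G : SimpleGraph V) [G.LocallyFinite] (l : ℝ) (U : V → ℝ) :
    Prop where
  sum : ∀ v, ∑ w ∈ G.neighborFinset v, U w = (l + ((G.degree v : ℝ) - 1) / l) * U v
  lt : ∀ ⦃v w⦄, G.Adj v w → U v < l * U w

open Classical in
lemma degree_levelGraph (n K : ℕ) (j : ℕ → ℕ) (hj : ∀ i, j i ≤ K)
    (v : Fin (n + 1) × (Fin K → ZMod 2)) :
    (levelGraph n K j).degree v =
      (if (v.1 : ℕ) < n then 1 else 0) + (if 0 < (v.1 : ℕ) then 1 else 0) + j v.1 := by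
  have := sum_neighbor_levelGraph n K j hj (fun _ => 1) v
  rw [Finset.sum_const, SimpleGraph.card_neighborFinset_eq_degree] at this
  simp only [nsmul_eq_mul, mul_one] at this
  exact_mod_cast this

open Classical in
lemma isBassFunction_levelGraph {l : ℝ} (hl : 1 < l) {n K : ℕ} {j : ℕ → ℕ} {U : ℕ → ℝ}
    (hn : 0 < n) (hj : ∀ i, j i ≤ K) (hU : IsLevelFunction l n j U) :
    IsBassFunction (levelGraph n K j) l (fun v => U v.1) where
  sum v := by
    rw [sum_neighbor_levelGraph n K j hj U v, degree_levelGraph n K j hj v]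
    obtain ⟨⟨i, hi⟩, s⟩ := v
    simp only
    rcases i with _ | i
    · have := hU.first
      simp only [hn, if_true, lt_irrefl, if_false, zero_add, add_zero]
      push_cast
      rw [this]; ring
    · rcases (show i + 1 < n ∨ i + 1 = n by omega) with h | h
      · have := hU.mid i h
        simp only [h, if_true, Nat.succ_pos, Nat.add_sub_cancel]
        push_cast
        linear_combination this
      · have := hU.last i h
        simp only [h, lt_irrefl, if_false, hn, if_true, zero_add]
        rw [show n - 1 = i by omega]
        push_cast
        linear_combination this
  lt := by
    rintro ⟨i, s⟩ ⟨i', s'⟩ (⟨h, -⟩ | ⟨-, h | h⟩)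
    · simp only at h; subst h
      have := hU.pos i
      nlinarith
    · simp only at h ⊢
      rw [h]; exact hU.lt_up _ (by omega)
    · simp only at h ⊢
      rw [h]; exact hU.lt_down _ (by omega)

lemma encard_neighborSet_eq_degree {V : Type*} (G : SimpleGraph V) [G.LocallyFinite] (v : V) :
    (G.neighborSet v).encard = G.degree v := by
  rw [← SimpleGraph.card_neighborFinset_eq_degree, ← SimpleGraph.coe_neighborFinset,
    Set.encard_coe_eq_coe_finsetCard]

lemma degreesIn_of_degree {V : Type*} {G : SimpleGraph V} [G.LocallyFinite] {a b : ℕ}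
    (h : ∀ v, a ≤ G.degree v ∧ G.degree v ≤ b) : DegreesIn G a b := by
  intro v
  rw [encard_neighborSet_eq_degree]
  exact_mod_cast h v

/-! ### Non-backtracking eigenvectors -/

lemma nonBacktrackingMatrix_mulVec {V : Type*} [Fintype V] [DecidableEq V] (G : SimpleGraph V)
    [DecidableRel G.Adj] (x : V → V → ℝ) (e : G.Dart) :
    (nonBacktrackingMatrix G).mulVec (fun f => x f.fst f.snd) e =
      ∑ w ∈ G.neighborFinset e.snd, x e.snd w - x e.snd e.fst := by
  rw [← Finset.sum_erase_eq_sub (by simp [e.adj.symm])]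
  simp only [Matrix.mulVec, dotProduct, nonBacktrackingMatrix, Matrix.of_apply, ite_mul, one_mul,
    zero_mul]
  rw [← Finset.sum_filter]
  refine Finset.sum_bij (fun f _ => f.snd) ?_ ?_ ?_ ?_
  · rintro f hf
    obtain ⟨h1, h2⟩ := (Finset.mem_filter.1 hf).2
    refine Finset.mem_erase.2 ⟨fun h => h2 ?_, ?_⟩
    · ext <;> simp [h, h1]
    · rw [h1]; simp [f.adj]
  · intro f hf f' hf' h
    have h1 := (Finset.mem_filter.1 hf).2.1
    have h2 := (Finset.mem_filter.1 hf').2.1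
    ext
    · rw [← h1, h2]
    · exact h
  · intro w hw
    obtain ⟨h1, h2⟩ := Finset.mem_erase.1 hw
    rw [SimpleGraph.mem_neighborFinset] at h2
    refine ⟨⟨(e.snd, w), h2⟩, ?_, rfl⟩
    refine Finset.mem_filter.2 ⟨Finset.mem_univ _, rfl, fun h => h1 ?_⟩
    simpa using congrArg (fun f : G.Dart => f.snd) h
  · rintro f hf
    rw [(Finset.mem_filter.1 hf).2.1]

/-- One step of the non-backtracking operator on the function `v → w ↦ l * U w - U v`; this is the
vertex form of the eigenvalue equation found by Ihara and Bass. -/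
lemma IsBassFunction.sum_sub {V : Type*} {G : SimpleGraph V} [G.LocallyFinite] {l : ℝ} {U : V → ℝ}
    (hU : IsBassFunction G l U) (hl : l ≠ 0) (v w : V) :
    ∑ u ∈ G.neighborFinset w, (l * U u - U w) - (l * U v - U w) = l * (l * U w - U v) := by
  rw [Finset.sum_sub_distrib, ← Finset.mul_sum, hU.sum, Finset.sum_const,
    SimpleGraph.card_neighborFinset_eq_degree, nsmul_eq_mul]
  field_simp
  ring

/-- A nonnegative matrix with a positive eigenvector has its eigenvalue as leading eigenvalue:
compare an eigenvector `y` for `z` with the positive one at an index where `‖y i‖ / x i` is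
largest. -/
lemma isLeadingEigenvalue_of_pos {ι : Type*} [Fintype ι] [DecidableEq ι] [Nonempty ι]
    {M : Matrix ι ι ℝ} {l : ℝ} {x : ι → ℝ} (hM : ∀ i k, 0 ≤ M i k) (hx : ∀ i, 0 < x i)
    (h : M.mulVec x = l • x) : IsLeadingEigenvalue M l := by
  constructor
  · refine Module.End.hasEigenvalue_of_hasEigenvector (x := x) ⟨?_, fun h0 => ?_⟩
    · rw [Module.End.mem_eigenspace_iff, Matrix.toLin'_apply, h]
    · obtain ⟨i⟩ := ‹Nonempty ι›
      exact (hx i).ne' (congrFun h0 i)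
  · intro z hz
    obtain ⟨y, hy, hy0⟩ := hz.exists_hasEigenvector
    rw [Module.End.mem_eigenspace_iff, Matrix.toLin'_apply] at hy
    obtain ⟨i, hi⟩ := Finite.exists_max fun i => ‖y i‖ / x i
    have hle : ∀ k, ‖y k‖ ≤ ‖y i‖ / x i * x k := fun k => by
      have := hi k; rwa [div_le_iff₀ (hx k)] at this
    have hyi : 0 < ‖y i‖ := by
      obtain ⟨k, hk⟩ := Function.ne_iff.1 hy0
      by_contra! hc
      have h1 := hle k
      rw [le_antisymm hc (norm_nonneg _), zero_div, zero_mul] at h1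
      exact hk (norm_le_zero_iff.1 h1)
    have h1 : ‖z‖ * ‖y i‖ ≤ l * ‖y i‖ := by
      calc ‖z‖ * ‖y i‖ = ‖∑ k, (M i k : ℂ) * y k‖ := by
            rw [← norm_mul, ← smul_eq_mul, ← Pi.smul_apply, ← hy]
            simp [Matrix.mulVec, dotProduct]
        _ ≤ ∑ k, M i k * ‖y k‖ := by
            refine (norm_sum_le _ _).trans (Finset.sum_le_sum fun k _ => ?_)
            rw [norm_mul, Complex.norm_real, Real.norm_of_nonneg (hM i k)]
        _ ≤ ∑ k, M i k * (‖y i‖ / x i * x k) :=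
            Finset.sum_le_sum fun k _ => mul_le_mul_of_nonneg_left (hle k) (hM i k)
        _ = ‖y i‖ / x i * M.mulVec x i := by
            simp only [Matrix.mulVec, dotProduct, Finset.mul_sum]
            exact Finset.sum_congr rfl fun k _ => by ring
        _ = l * ‖y i‖ := by
            rw [h, Pi.smul_apply, smul_eq_mul]
            have := (hx i).ne'
            field_simp
    exact le_of_mul_le_mul_right h1 hyi

lemma IsBassFunction.isLeadingEigenvalue {V : Type*} [Fintype V] [DecidableEq V]
    {G : SimpleGraph V} [DecidableRel G.Adj] [Nonempty G.Dart] {l : ℝ} {U : V → ℝ}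
    (hU : IsBassFunction G l U) (hl : l ≠ 0) :
    IsLeadingEigenvalue (nonBacktrackingMatrix G) l := by
  refine isLeadingEigenvalue_of_pos (x := fun e => l * U e.snd - U e.fst) (fun e f => ?_)
    (fun e => sub_pos.2 (hU.lt e.adj)) ?_
  · simp only [nonBacktrackingMatrix, Matrix.of_apply]
    split_ifs <;> norm_num
  · ext e
    rw [nonBacktrackingMatrix_mulVec G (fun v w => l * U w - U v) e, hU.sum_sub hl, Pi.smul_apply,
      smul_eq_mul]

/-! ### Spheres in trees -/

section Sphere

variable {W : Type*} {T : SimpleGraph W}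

lemma exists_adj_dist_add_one (hT : T.Connected) {v w : W} (h : v ≠ w) :
    ∃ u, T.Adj u w ∧ T.dist v u + 1 = T.dist v w := by
  obtain ⟨p, hp⟩ := hT.exists_walk_length_eq_dist w v
  cases p with
  | nil => exact absurd rfl h
  | cons hadj p =>
    rename_i u
    refine ⟨u, hadj.symm, ?_⟩
    have h1 := SimpleGraph.dist_le p
    have h2 := hT.dist_triangle (u := v) (v := u) (w := w)
    have h3 : T.dist u w = 1 := SimpleGraph.dist_eq_one_iff_adj.2 hadj.symm
    rw [SimpleGraph.Walk.length_cons, SimpleGraph.dist_comm] at hp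
    rw [SimpleGraph.dist_comm] at h1
    omega

lemma eq_of_dist_add_one (hT : T.IsTree) {v w u u' : W} (hu : T.Adj u w) (hu' : T.Adj u' w)
    (h : T.dist v u + 1 = T.dist v w) (h' : T.dist v u' + 1 = T.dist v w) : u = u' := by
  obtain ⟨p, hp⟩ := hT.connected.exists_walk_length_eq_dist v u
  obtain ⟨p', hp'⟩ := hT.connected.exists_walk_length_eq_dist v u'
  have h1 : (p.concat hu).IsPath := SimpleGraph.Walk.isPath_of_length_eq_dist _ (by simp [hp, h])
  have h2 : (p'.concat hu').IsPath :=
    SimpleGraph.Walk.isPath_of_length_eq_dist _ (by simp [hp', h'])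
  have h3 := (hT.existsUnique_path v w).unique h1 h2
  simpa using congrArg SimpleGraph.Walk.penultimate h3

open Classical in
/-- The neighbour of `w` that is closer to `v` (and `w` itself if there is none). -/
noncomputable def towards (T : SimpleGraph W) (v w : W) : W :=
  if h : ∃ u, T.Adj u w ∧ T.dist v u + 1 = T.dist v w then h.choose else w

lemma towards_spec (hT : T.Connected) {v w : W} (h : v ≠ w) :
    T.Adj (towards T v w) w ∧ T.dist v (towards T v w) + 1 = T.dist v w := by
  have := exists_adj_dist_add_one hT h
  rw [towards, dif_pos this]
  exact this.choose_spec

lemma towards_eq (hT : T.IsTree) {v w u : W} (hu : T.Adj u w) (h : T.dist v u + 1 = T.dist v w) :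
    towards T v w = u := by
  have hvw : v ≠ w := by rintro rfl; simp at h
  have := towards_spec hT.connected hvw
  exact eq_of_dist_add_one hT this.1 hu this.2 h

open Classical in
/-- The sphere of radius `n` around `v`, as a finite set. -/
noncomputable def sphereFinset (T : SimpleGraph W) [T.LocallyFinite] (v : W) : ℕ → Finset W
  | 0 => {v}
  | n + 1 => (sphereFinset T v n).biUnion fun w =>
      (T.neighborFinset w).filter fun c => T.dist v c = n + 1

variable [T.LocallyFinite]

lemma mem_sphereFinset (hT : T.Connected) {v w : W} {n : ℕ} :
    w ∈ sphereFinset T v n ↔ T.dist v w = n := by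
  induction n generalizing w with
  | zero => simp [sphereFinset, hT.dist_eq_zero_iff, eq_comm]
  | succ n ih =>
    simp only [sphereFinset, Finset.mem_biUnion, Finset.mem_filter, SimpleGraph.mem_neighborFinset,
      ih]
    constructor
    · rintro ⟨_, _, _, h⟩; exact h
    · intro h
      have hvw : v ≠ w := by rintro rfl; simp at h
      obtain ⟨u, hu, hd⟩ := exists_adj_dist_add_one hT hvw
      exact ⟨u, by omega, hu, h⟩

lemma coe_sphereFinset (hT : T.Connected) (v : W) (n : ℕ) :
    (sphereFinset T v n : Set W) = graphSphere T v n := by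
  ext w; simp [mem_sphereFinset hT, graphSphere]

lemma ncard_graphSphere (hT : T.Connected) (v : W) (n : ℕ) :
    (graphSphere T v n).ncard = (sphereFinset T v n).card := by
  rw [← coe_sphereFinset hT, Set.ncard_coe_finset]

/-- The total weight, for weights `ψ` on oriented edges, of the edges that lead into the sphere of
radius `n` from inside. -/
noncomputable def sphereWeight (T : SimpleGraph W) [T.LocallyFinite] (ψ : W → W → ℝ) (v : W)
    (n : ℕ) : ℝ :=
  ∑ w ∈ sphereFinset T v n, ψ (towards T v w) w

lemma sphereWeight_one (hT : T.IsTree) (ψ : W → W → ℝ) (v : W) :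
    sphereWeight T ψ v 1 = ∑ w ∈ T.neighborFinset v, ψ v w := by
  have h1 : sphereFinset T v 1 = T.neighborFinset v := by
    ext w
    rw [mem_sphereFinset hT.connected, SimpleGraph.mem_neighborFinset,
      SimpleGraph.dist_eq_one_iff_adj]
  rw [sphereWeight, h1]
  refine Finset.sum_congr rfl fun w hw => ?_
  rw [SimpleGraph.mem_neighborFinset] at hw
  rw [towards_eq hT hw (by simp [SimpleGraph.dist_eq_one_iff_adj.2 hw])]

open Classical in
lemma sphereWeight_add_two (hT : T.IsTree) (ψ : W → W → ℝ) (v : W) (n : ℕ) :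
    sphereWeight T ψ v (n + 2) =
      ∑ w ∈ sphereFinset T v (n + 1), ∑ c ∈ (T.neighborFinset w).erase (towards T v w), ψ w c := by
  rw [sphereWeight, sphereFinset, Finset.sum_biUnion]
  · refine Finset.sum_congr rfl fun w hw => ?_
    rw [mem_sphereFinset hT.connected] at hw
    have hvw : v ≠ w := by rintro rfl; simp at hw
    have hpar := towards_spec hT.connected hvw
    have hset : (T.neighborFinset w).filter (fun c => T.dist v c = n + 1 + 1) =
        (T.neighborFinset w).erase (towards T v w) := by
      ext c
      rw [Finset.mem_filter, Finset.mem_erase, SimpleGraph.mem_neighborFinset, and_comm]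
      refine and_congr_left fun hc => ⟨?_, fun hne => ?_⟩
      · rintro h rfl; omega
      · rcases hT.dist_eq_dist_add_one_of_adj v hc with h | h
        · exact absurd (towards_eq hT hc.symm h.symm).symm hne
        · omega
    rw [← hset]
    refine Finset.sum_congr rfl fun c hc => ?_
    rw [Finset.mem_filter, SimpleGraph.mem_neighborFinset] at hc
    rw [towards_eq hT hc.1 (by omega)]
  · intro w hw w' hw' hne
    rw [Function.onFun, Finset.disjoint_left]
    intro c hc hc'
    rw [Finset.mem_coe, mem_sphereFinset hT.connected] at hw hw'
    rw [Finset.mem_filter, SimpleGraph.mem_neighborFinset] at hc hc'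
    exact hne (eq_of_dist_add_one hT hc.1 hc'.1 (v := v) (by omega) (by omega))

open Classical in
lemma le_sphereWeight (hT : T.IsTree) {ψ : W → W → ℝ} {b : ℝ} (hb : 0 ≤ b)
    (h : ∀ p w, T.Adj p w → b * ψ p w ≤ ∑ c ∈ (T.neighborFinset w).erase p, ψ w c) (v : W) (n : ℕ) :
    b ^ n * sphereWeight T ψ v 1 ≤ sphereWeight T ψ v (n + 1) := by
  induction n with
  | zero => simp
  | succ n ih =>
    rw [sphereWeight_add_two hT, pow_succ', mul_assoc]
    refine (mul_le_mul_of_nonneg_left ih hb).trans ?_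
    rw [sphereWeight, Finset.mul_sum]
    refine Finset.sum_le_sum fun w hw => h _ _ ?_
    rw [mem_sphereFinset hT.connected] at hw
    exact (towards_spec hT.connected (by rintro rfl; simp at hw)).1

open Classical in
lemma sphereWeight_le (hT : T.IsTree) {ψ : W → W → ℝ} {b : ℝ} (hb : 0 ≤ b)
    (h : ∀ p w, T.Adj p w → ∑ c ∈ (T.neighborFinset w).erase p, ψ w c ≤ b * ψ p w) (v : W) (n : ℕ) :
    sphereWeight T ψ v (n + 1) ≤ b ^ n * sphereWeight T ψ v 1 := by
  induction n with
  | zero => simp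
  | succ n ih =>
    rw [sphereWeight_add_two hT, pow_succ', mul_assoc]
    refine le_trans ?_ (mul_le_mul_of_nonneg_left ih hb)
    rw [sphereWeight, Finset.mul_sum]
    refine Finset.sum_le_sum fun w hw => h _ _ ?_
    rw [mem_sphereFinset hT.connected] at hw
    exact (towards_spec hT.connected (by rintro rfl; simp at hw)).1

/-! ### Growth rates of trees -/

lemma tendsto_const_rpow_one_div {c : ℝ} (hc : 0 < c) :
    Tendsto (fun n : ℕ => c ^ (1 / (n : ℝ))) atTop (𝓝 1) := by
  have := (tendsto_const_nhds (x := c)).rpow (tendsto_one_div_atTop_nhds_zero_nat (𝕜 := ℝ))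
    (Or.inl hc.ne')
  simpa using this

lemma tendsto_nat_rpow_one_div :
    Tendsto (fun n : ℕ => (n : ℝ) ^ (1 / (n : ℝ))) atTop (𝓝 1) :=
  tendsto_rpow_div.comp tendsto_natCast_atTop_atTop

lemma tendsto_rpow_one_div_of_bounds {a : ℕ → ℝ} {b c C : ℝ} (hb : 0 < b) (hc : 0 < c) (hC : 0 < C)
    (h1 : ∀ n, 0 < n → c * b ^ n ≤ a n) (h2 : ∀ n : ℕ, 0 < n → a n ≤ C * n * b ^ n) :
    Tendsto (fun n : ℕ => a n ^ (1 / (n : ℝ))) atTop (𝓝 b) := by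
  have hpow : ∀ n : ℕ, 0 < n → (b ^ n) ^ (1 / (n : ℝ)) = b := fun n hn => by
    rw [one_div, Real.pow_rpow_inv_natCast hb.le hn.ne']
  have hlo : Tendsto (fun n : ℕ => c ^ (1 / (n : ℝ)) * b) atTop (𝓝 b) := by
    simpa using (tendsto_const_rpow_one_div hc).mul_const b
  have hhi : Tendsto (fun n : ℕ => C ^ (1 / (n : ℝ)) * (n : ℝ) ^ (1 / (n : ℝ)) * b) atTop (𝓝 b) := by
    simpa using ((tendsto_const_rpow_one_div hC).mul tendsto_nat_rpow_one_div).mul_const b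
  refine tendsto_of_tendsto_of_tendsto_of_le_of_le' hlo hhi ?_ ?_
  · filter_upwards [eventually_gt_atTop 0] with n hn
    calc c ^ (1 / (n : ℝ)) * b = (c * b ^ n) ^ (1 / (n : ℝ)) := by
          rw [Real.mul_rpow hc.le (by positivity), hpow n hn]
      _ ≤ a n ^ (1 / (n : ℝ)) := Real.rpow_le_rpow (by positivity) (h1 n hn) (by positivity)
  · filter_upwards [eventually_gt_atTop 0] with n hn
    have h0 : 0 ≤ a n := le_trans (by positivity) (h1 n hn)
    calc a n ^ (1 / (n : ℝ)) ≤ (C * n * b ^ n) ^ (1 / (n : ℝ)) :=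
          Real.rpow_le_rpow h0 (h2 n hn) (by positivity)
      _ = C ^ (1 / (n : ℝ)) * (n : ℝ) ^ (1 / (n : ℝ)) * b := by
          rw [Real.mul_rpow (by positivity) (by positivity), hpow n hn,
            Real.mul_rpow hC.le (by positivity)]

lemma graphBall_eq_biUnion (hT : T.Connected) (v : W) (n : ℕ) :
    open Classical in graphBall T v n =
      (((Finset.range (n + 1)).biUnion (sphereFinset T v) : Finset W) : Set W) := by
  ext w
  simp [graphBall, mem_sphereFinset hT]

/-- If all spheres around all vertices grow like `b ^ n` up to constants, then `b` is the growth
rate. -/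
lemma hasGrowthRate_of_bounds (hT : T.Connected) {b : ℝ} (hb : 1 ≤ b)
    (h : ∀ v, ∃ c C : ℝ, 0 < c ∧ 0 < C ∧ ∀ n, 0 < n →
      c * b ^ n ≤ (sphereFinset T v n).card ∧ ((sphereFinset T v n).card : ℝ) ≤ C * b ^ n) :
    HasGrowthRate T b := by
  classical
  intro v
  obtain ⟨c, C, hc, hC, hcC⟩ := h v
  have hb0 : 0 < b := by linarith
  constructor
  · refine tendsto_rpow_one_div_of_bounds hb0 hc (by positivity : 0 < 2 * (1 + C)) (fun n hn => ?_)
      (fun n hn => ?_)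
    · rw [graphBall_eq_biUnion hT, Set.ncard_coe_finset]
      refine (hcC n hn).1.trans ?_
      exact_mod_cast Finset.card_le_card
        (Finset.subset_biUnion_of_mem _ (Finset.mem_range.2 (Nat.lt_succ_self n)))
    · rw [graphBall_eq_biUnion hT, Set.ncard_coe_finset]
      have h1 : (((Finset.range (n + 1)).biUnion (sphereFinset T v)).card : ℝ) ≤
          ∑ k ∈ Finset.range (n + 1), ((sphereFinset T v k).card : ℝ) := by
        exact_mod_cast Finset.card_biUnion_le
      have h2 : ∀ k ∈ Finset.range (n + 1), ((sphereFinset T v k).card : ℝ) ≤ (1 + C) * b ^ n := by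
        intro k hk
        have hk' : k ≤ n := Nat.lt_succ_iff.1 (Finset.mem_range.1 hk)
        rcases Nat.eq_zero_or_pos k with rfl | hk0
        · have : (1 : ℝ) ≤ b ^ n := one_le_pow₀ hb
          simp only [sphereFinset, Finset.card_singleton, Nat.cast_one]
          nlinarith
        · have : b ^ k ≤ b ^ n := pow_le_pow_right₀ hb hk'
          have := (hcC k hk0).2
          nlinarith [pow_pos hb0 n]
      refine h1.trans ((Finset.sum_le_card_nsmul _ _ _ h2).trans ?_)
      rw [Finset.card_range, nsmul_eq_mul]
      have : (1 : ℝ) ≤ n := by exact_mod_cast hn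
      push_cast
      have hp : 0 < (1 + C) * b ^ n := by positivity
      nlinarith
  · refine tendsto_rpow_one_div_of_bounds hb0 hc hC (fun n hn => ?_) (fun n hn => ?_)
    · rw [ncard_graphSphere hT]; exact (hcC n hn).1
    · rw [ncard_graphSphere hT]
      refine (hcC n hn).2.trans ?_
      have : (1 : ℝ) ≤ n := by exact_mod_cast hn
      have hp : 0 < C * b ^ n := by positivity
      nlinarith

/-- The weight `l * U w - U v` of an edge `v → w` is multiplied by `l` from each sphere to the next,
and it is comparable to `1`. -/
lemma IsBassFunction.hasGrowthRate (hT : T.IsTree) (hdeg : ∀ v, 0 < T.degree v) {l m M : ℝ}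
    {U : W → ℝ} (hU : IsBassFunction T l U) (hl : 1 ≤ l) (hm : 0 < m)
    (hmU : ∀ v w, T.Adj v w → m ≤ l * U w - U v) (hM : ∀ v w, T.Adj v w → l * U w - U v ≤ M) :
    HasGrowthRate T l := by
  classical
  refine hasGrowthRate_of_bounds hT.connected hl fun v => ?_
  have hl0 : 0 < l := by linarith
  set ψ : W → W → ℝ := fun v w => l * U w - U v with hψ
  have hstep : ∀ p w, T.Adj p w →
      ∑ c ∈ (T.neighborFinset w).erase p, ψ w c = l * ψ p w := by
    intro p w hpw
    rw [Finset.sum_erase_eq_sub (by simp [hpw.symm])]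
    exact hU.sum_sub hl0.ne' p w
  obtain ⟨u, hu⟩ := Finset.card_pos.1 (by simpa using hdeg v : 0 < (T.neighborFinset v).card)
  rw [SimpleGraph.mem_neighborFinset] at hu
  have hM0 : 0 < M := hm.trans_le ((hmU v u hu).trans (hM v u hu))
  set X := sphereWeight T ψ v 1 with hX
  have hX0 : 0 < X := by
    rw [hX, sphereWeight_one hT]
    refine Finset.sum_pos (fun w hw => ?_) ⟨u, by simpa using hu⟩
    exact hm.trans_le (hmU v w (by simpa using hw))
  refine ⟨X / (M * l), X / (m * l), by positivity, by positivity, fun n hn => ?_⟩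
  obtain ⟨n, rfl⟩ := Nat.exists_eq_succ_of_ne_zero hn.ne'
  have hadj : ∀ w ∈ sphereFinset T v (n + 1), T.Adj (towards T v w) w := fun w hw => by
    rw [mem_sphereFinset hT.connected] at hw
    exact (towards_spec hT.connected (by rintro rfl; simp at hw)).1
  have h1 := le_sphereWeight hT hl0.le (fun p w h => (hstep p w h).ge) v n
  have h2 := sphereWeight_le hT hl0.le (fun p w h => (hstep p w h).le) v n
  have h3 : sphereWeight T ψ v (n + 1) ≤ (sphereFinset T v (n + 1)).card * M := by
    rw [← nsmul_eq_mul]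
    exact Finset.sum_le_card_nsmul _ _ _ fun w hw => hM _ _ (hadj w hw)
  have h4 : (sphereFinset T v (n + 1)).card * m ≤ sphereWeight T ψ v (n + 1) := by
    rw [← nsmul_eq_mul]
    exact Finset.card_nsmul_le_sum _ _ _ fun w hw => hmU _ _ (hadj w hw)
  rw [← hX] at h1 h2
  rw [Nat.succ_eq_add_one, pow_succ]
  constructor
  · rw [div_mul_eq_mul_div, div_le_iff₀ (by positivity)]
    nlinarith
  · rw [div_mul_eq_mul_div, le_div_iff₀ (by positivity)]
    nlinarith

/-- A vertex of degree `k` in a sphere has `k - 1` neighbours in the next one, and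
`1 ≤ k - 1 ≤ d - 1`. -/
lemma HasGrowthRate.mem_Icc (hT : T.IsTree) {d : ℕ} (hdeg : ∀ v, 2 ≤ T.degree v)
    (hdeg' : ∀ v, T.degree v ≤ d) {g : ℝ} (hg : HasGrowthRate T g) :
    g ∈ Set.Icc (1 : ℝ) (d - 1) := by
  classical
  obtain ⟨v⟩ := hT.connected.nonempty
  have hg := (hg v).2
  have hd : 2 ≤ d := (hdeg v).trans (hdeg' v)
  have hd1 : (1 : ℝ) ≤ d - 1 := by
    have : (2 : ℝ) ≤ d := by exact_mod_cast hd
    linarith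
  have hcard : ∀ p w, T.Adj p w →
      ∑ c ∈ (T.neighborFinset w).erase p, (1 : ℝ) = T.degree w - 1 := by
    intro p w hpw
    rw [Finset.sum_erase_eq_sub (by simp [hpw.symm])]
    simp
  have hW : ∀ n, sphereWeight T (fun _ _ => 1) v n = (graphSphere T v n).ncard := by
    intro n
    rw [ncard_graphSphere hT.connected]
    simp [sphereWeight]
  have hlow : ∀ n, (1 : ℝ) ≤ (graphSphere T v (n + 1)).ncard := by
    intro n
    have h1 := le_sphereWeight hT zero_le_one (ψ := fun _ _ => (1 : ℝ)) (fun p w h => by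
      have : (2 : ℝ) ≤ T.degree w := by exact_mod_cast hdeg w
      rw [hcard p w h]; linarith) v n
    rw [sphereWeight_one hT, hW] at h1
    have : (2 : ℝ) ≤ T.degree v := by exact_mod_cast hdeg v
    simp only [one_pow, Finset.sum_const, SimpleGraph.card_neighborFinset_eq_degree, nsmul_eq_mul,
      mul_one, one_mul] at h1
    linarith
  have hup : ∀ n, ((graphSphere T v (n + 1)).ncard : ℝ) ≤ (d - 1) ^ n * d := by
    intro n
    have h1 := sphereWeight_le hT (by linarith : (0 : ℝ) ≤ d - 1) (ψ := fun _ _ => (1 : ℝ))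
      (fun p w h => by
        have : (T.degree w : ℝ) ≤ d := by exact_mod_cast hdeg' w
        rw [hcard p w h]; linarith) v n
    rw [sphereWeight_one hT, hW] at h1
    have : (T.degree v : ℝ) ≤ d := by exact_mod_cast hdeg' v
    simp only [Finset.sum_const, SimpleGraph.card_neighborFinset_eq_degree, nsmul_eq_mul,
      mul_one] at h1
    exact h1.trans (by gcongr)
  constructor
  · refine ge_of_tendsto hg ?_
    filter_upwards [eventually_gt_atTop 0] with n hn
    obtain ⟨n, rfl⟩ := Nat.exists_eq_succ_of_ne_zero hn.ne'
    exact Real.one_le_rpow (hlow n) (by positivity)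
  · have hlim : Tendsto (fun n : ℕ => ((d : ℝ) * (d - 1) ^ n) ^ (1 / (n : ℝ))) atTop
        (𝓝 (d - 1)) := by
      refine tendsto_rpow_one_div_of_bounds (by linarith) (by positivity : (0 : ℝ) < d)
        (by positivity : (0 : ℝ) < d) (fun n _ => le_rfl) fun n hn => ?_
      have : (1 : ℝ) ≤ n := by exact_mod_cast hn
      have hp : 0 < (d - 1 : ℝ) ^ n := pow_pos (by linarith) n
      gcongr
      nlinarith
    refine le_of_tendsto_of_tendsto hg hlim ?_
    filter_upwards [eventually_gt_atTop 0] with n hn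
    obtain ⟨n, rfl⟩ := Nat.exists_eq_succ_of_ne_zero hn.ne'
    refine Real.rpow_le_rpow (by positivity) ?_ (by positivity)
    refine (hup n).trans ?_
    rw [mul_comm]
    gcongr
    exact Nat.le_succ n

end Sphere

/-! ### Universal covers -/

/-- The reduced walks in `G` that start at `o`, written as the list of their vertices, last vertex
first. -/
inductive IsReducedFrom {V : Type*} (G : SimpleGraph V) (o : V) : List V → Prop
  | base : IsReducedFrom G o [o]
  | first {u : V} : G.Adj o u → IsReducedFrom G o [u, o]
  | step {u p q : V} {l : List V} : IsReducedFrom G o (p :: q :: l) → G.Adj p u → u ≠ q →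
      IsReducedFrom G o (u :: p :: q :: l)

namespace IsReducedFrom

variable {V : Type*} {G : SimpleGraph V} {o : V}

lemma ne_nil {l : List V} (h : IsReducedFrom G o l) : l ≠ [] := by
  cases h <;> simp

lemma tail {u p : V} {l : List V} (h : IsReducedFrom G o (u :: p :: l)) :
    IsReducedFrom G o (p :: l) := by
  cases h with
  | first _ => exact base
  | step h _ _ => exact h

lemma adj {u p : V} {l : List V} (h : IsReducedFrom G o (u :: p :: l)) : G.Adj p u := by
  cases h with
  | first h => exact h
  | step _ h _ => exact h

lemma eq_base {u : V} (h : IsReducedFrom G o [u]) : u = o := by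
  cases h; rfl

end IsReducedFrom

/-- The universal cover of `G` with base point `o`: its vertices are the reduced walks from `o`, and
a walk is adjacent to its extensions by one step. -/
def reducedWalkTree {V : Type*} (G : SimpleGraph V) (o : V) :
    SimpleGraph {l : List V // IsReducedFrom G o l} where
  Adj a b := (∃ u, b.1 = u :: a.1) ∨ ∃ u, a.1 = u :: b.1
  symm := ⟨fun _ _ h => h.symm⟩
  loopless := ⟨by rintro a (⟨u, h⟩ | ⟨u, h⟩) <;> simpa using congrArg List.length h⟩

section

variable {V : Type*} (G : SimpleGraph V) (o : V)

/-- The end point of a reduced walk. -/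
def reducedWalkEnd (a : {l : List V // IsReducedFrom G o l}) : V := a.1.head a.2.ne_nil

lemma reducedWalkEnd_of_eq {a : {l : List V // IsReducedFrom G o l}} {u : V} {l : List V}
    (h : a.1 = u :: l) : reducedWalkEnd G o a = u := by
  simp [reducedWalkEnd, h]

lemma reducedWalkTree_connected : (reducedWalkTree G o).Connected := by
  have key : ∀ (l : List V) (h : IsReducedFrom G o l),
      (reducedWalkTree G o).Reachable ⟨l, h⟩ ⟨[o], .base⟩ := by
    intro l
    induction l with
    | nil => intro h; exact absurd rfl h.ne_nil
    | cons u l ih =>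
      intro h
      cases l with
      | nil => obtain rfl := h.eq_base; rfl
      | cons p l =>
        exact (SimpleGraph.Adj.reachable (Or.inr ⟨u, rfl⟩)).trans (ih h.tail)
  have : Nonempty {l : List V // IsReducedFrom G o l} := ⟨⟨[o], .base⟩⟩
  exact ⟨fun a b => (key a.1 a.2).trans (key b.1 b.2).symm⟩

/-- The walks that extend a given walk `b` can only be left through the edge from `b` to its
truncation `a`, so every edge is a bridge. -/
lemma reducedWalkTree_isAcyclic : (reducedWalkTree G o).IsAcyclic := by
  rw [SimpleGraph.isAcyclic_iff_forall_adj_isBridge]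
  have key : ∀ a b : {l : List V // IsReducedFrom G o l}, (∃ u, b.1 = u :: a.1) →
      (reducedWalkTree G o).IsBridge s(a, b) := by
    rintro a b ⟨u, hu⟩
    rw [SimpleGraph.isBridge_iff]
    rintro ⟨p⟩
    have hclosed : ∀ {c d} (p : ((reducedWalkTree G o).deleteEdges {s(a, b)}).Walk c d),
        b.1 <:+ d.1 → b.1 <:+ c.1 := by
      intro c d p
      induction p with
      | nil => exact id
      | @cons c e d hadj p ih =>
        intro hd
        have he := ih hd
        rw [SimpleGraph.deleteEdges_adj] at hadj
        obtain ⟨⟨x, hx⟩ | ⟨x, hx⟩, hne⟩ := hadj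
        · rw [hx, List.suffix_cons_iff] at he
          rcases he with he | he
          · refine absurd ?_ hne
            rw [hu, List.cons.injEq] at he
            have hca : c = a := Subtype.ext he.2.symm
            have heb : e = b := Subtype.ext (by rw [hx, hu, he.1, he.2])
            simp [hca, heb]
          · exact he
        · rw [hx]; exact he.trans (List.suffix_cons _ _)
    have := (hclosed p List.suffix_rfl).length_le
    rw [hu] at this
    simp at this
  rintro a b (h | h)
  · exact key a b h
  · rw [Sym2.eq_swap]; exact key b a h

lemma reducedWalkEnd_adj {a b : {l : List V // IsReducedFrom G o l}}
    (h : (reducedWalkTree G o).Adj a b) : G.Adj (reducedWalkEnd G o a) (reducedWalkEnd G o b) := by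
  have key : ∀ a b : {l : List V // IsReducedFrom G o l}, (∃ u, b.1 = u :: a.1) →
      G.Adj (reducedWalkEnd G o a) (reducedWalkEnd G o b) := by
    rintro ⟨a, ha⟩ ⟨b, hb⟩ ⟨u, hu⟩
    simp only at hu
    subst hu
    cases a with
    | nil => exact absurd rfl ha.ne_nil
    | cons p l => exact hb.adj
  rcases h with h | h
  · exact key a b h
  · exact (key b a h).symm

/-- The covering map from the universal cover. -/
def reducedWalkHom : reducedWalkTree G o →g G where
  toFun := reducedWalkEnd G o
  map_rel' := reducedWalkEnd_adj G o

/-- At the end point of a reduced walk, the step back leads to its truncation and every other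
neighbour to an extension. -/
lemma reducedWalkHom_bijOn (a : {l : List V // IsReducedFrom G o l}) :
    Set.BijOn (reducedWalkHom G o) ((reducedWalkTree G o).neighborSet a)
      (G.neighborSet (reducedWalkHom G o a)) := by
  refine ⟨fun b hb => (reducedWalkHom G o).map_adj hb, ?_, ?_⟩
  · have hup : ∀ b : {l : List V // IsReducedFrom G o l}, (∃ u, b.1 = u :: a.1) →
        b.1 = reducedWalkEnd G o b :: a.1 := by
      rintro b ⟨u, hu⟩
      rw [reducedWalkEnd_of_eq G o hu]; exact hu
    -- an extension never ends in the vertex where the truncation ends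
    have hmixed : ∀ b c : {l : List V // IsReducedFrom G o l}, (∃ u, b.1 = u :: a.1) →
        (∃ u, a.1 = u :: c.1) → reducedWalkEnd G o b ≠ reducedWalkEnd G o c := by
      rintro ⟨b, hb⟩ ⟨c, hc⟩ ⟨u, hu⟩ ⟨p, hp⟩
      cases c with
      | nil => exact absurd rfl hc.ne_nil
      | cons q l =>
        simp only at hu hp
        rw [hp] at hu
        subst hu
        cases hb with
        | step _ _ h => exact h
    rintro b hb c hc (hbc : reducedWalkEnd G o b = reducedWalkEnd G o c)
    rcases hb with hb | hb <;> rcases hc with hc | hc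
    · exact Subtype.ext (by rw [hup b hb, hup c hc, hbc])
    · exact absurd hbc (hmixed b c hb hc)
    · exact absurd hbc.symm (hmixed c b hc hb)
    · obtain ⟨u, hu⟩ := hb
      obtain ⟨u', hu'⟩ := hc
      rw [hu, List.cons.injEq] at hu'
      exact Subtype.ext hu'.2
  · rintro u (hu : G.Adj (reducedWalkEnd G o a) u)
    obtain ⟨a, ha⟩ := a
    match a, ha with
    | [], ha => exact absurd rfl ha.ne_nil
    | [p], ha =>
      obtain rfl := ha.eq_base
      exact ⟨⟨[u, p], .first hu⟩, Or.inl ⟨u, rfl⟩, rfl⟩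
    | p :: q :: l, ha =>
      by_cases huq : u = q
      · subst huq
        exact ⟨⟨u :: l, ha.tail⟩, Or.inr ⟨p, rfl⟩, rfl⟩
      · exact ⟨⟨u :: p :: q :: l, .step ha hu huq⟩, Or.inl ⟨u, rfl⟩, rfl⟩

lemma isUniversalCover_reducedWalkTree (hG : G.Connected) :
    IsUniversalCover (reducedWalkTree G o) G := by
  refine ⟨⟨reducedWalkTree_connected G o, reducedWalkTree_isAcyclic G o⟩, reducedWalkHom G o, ?_,
    reducedWalkHom_bijOn G o⟩
  have key : ∀ {v w : V} (p : G.Walk v w), (∃ a, reducedWalkHom G o a = w) →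
      ∃ a, reducedWalkHom G o a = v := by
    intro v w p
    induction p with
    | nil => exact id
    | cons hadj p ih =>
      intro hw
      obtain ⟨a, ha⟩ := ih hw
      obtain ⟨b, -, hb⟩ := (reducedWalkHom_bijOn G o a).surjOn (ha ▸ hadj.symm)
      exact ⟨b, hb⟩
  intro v
  obtain ⟨p⟩ := hG v o
  exact key p ⟨⟨[o], .base⟩, rfl⟩

end

section Covering

variable {W V : Type*} {T : SimpleGraph W} {G : SimpleGraph V} {f : T →g G}

lemma IsGraphCovering.encard_neighborSet (hf : IsGraphCovering f) (w : W) :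
    (T.neighborSet w).encard = (G.neighborSet (f w)).encard := by
  rw [← (hf.2 w).image_eq, (hf.2 w).injOn.encard_image]

lemma IsGraphCovering.degreesIn (hf : IsGraphCovering f) {a b : ℕ} (h : DegreesIn G a b) :
    DegreesIn T a b := fun w => by
  rw [hf.encard_neighborSet]; exact h _

lemma IsGraphCovering.sum_neighborFinset [T.LocallyFinite] [G.LocallyFinite]
    (hf : IsGraphCovering f) (w : W) (g : V → ℝ) :
    ∑ u ∈ T.neighborFinset w, g (f u) = ∑ u ∈ G.neighborFinset (f w), g u := by
  refine Finset.sum_bij (fun u _ => f u) (fun u hu => ?_) (fun u hu u' hu' h => ?_)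
    (fun u hu => ?_) fun _ _ => rfl
  · simp only [SimpleGraph.mem_neighborFinset] at hu ⊢
    exact f.map_adj hu
  · simp only [SimpleGraph.mem_neighborFinset] at hu hu'
    exact (hf.2 w).injOn hu hu' h
  · rw [SimpleGraph.mem_neighborFinset] at hu
    obtain ⟨u', h, h'⟩ := (hf.2 w).surjOn hu
    exact ⟨u', by simpa using h, h'⟩

lemma IsBassFunction.comp_covering [T.LocallyFinite] [G.LocallyFinite] {l : ℝ} {U : V → ℝ}
    (hU : IsBassFunction G l U) (hf : IsGraphCovering f) : IsBassFunction T l (fun w => U (f w)) where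
  sum w := by
    have hdeg : (T.degree w : ℝ) = G.degree (f w) := by
      have := hf.sum_neighborFinset w (fun _ => 1)
      simpa using this
    rw [hf.sum_neighborFinset w U, hU.sum, hdeg]
  lt _ _ h := hU.lt (f.map_adj h)

end Covering

lemma DegreesIn.finite_neighborSet {V : Type*} {G : SimpleGraph V} {a b : ℕ} (h : DegreesIn G a b)
    (v : V) : (G.neighborSet v).Finite :=
  Set.finite_of_encard_le_coe (h v).2

lemma DegreesIn.degree {V : Type*} {G : SimpleGraph V} [G.LocallyFinite] {a b : ℕ}
    (h : DegreesIn G a b) (v : V) : a ≤ G.degree v ∧ G.degree v ≤ b := by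
  have := h v
  rw [encard_neighborSet_eq_degree] at this
  exact_mod_cast this

/-! ### Density -/

open Classical in
lemma exists_graph_near {r : ℕ} {α ε : ℝ} (hα : α ∈ Set.Ioo (1 : ℝ) (2 * (r : ℝ) - 1))
    (hε : 0 < ε) :
    ∃ (V : Type) (_ : Fintype V) (G : SimpleGraph V) (l : ℝ) (U : V → ℝ),
      G.Connected ∧ DegreesIn G 2 (2 * r) ∧ 1 < l ∧ |l - α| < ε ∧ IsBassFunction G l U := by
  obtain ⟨l, n, j, U, hl, hlα, hn, hU, hjn, hj0, hj0α, hj⟩ := exists_isLevelFunction_near hα.1 hε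
  have hjK : ∀ i, j i ≤ j 0 := fun i => by
    rcases i with _ | i
    · exact le_rfl
    · exact (hj i).le
  have hj2r : j 0 + 1 ≤ 2 * r := by
    have : (j 0 : ℝ) < (2 * r : ℕ) := by push_cast; linarith [hα.2]
    exact_mod_cast this
  refine ⟨_, inferInstance, levelGraph n (j 0) j, l, fun v => U v.1, levelGraph_connected n _ j rfl,
    degreesIn_of_degree fun v => ?_, hl, hlα, isBassFunction_levelGraph hl hn hjK hU⟩
  rw [degree_levelGraph n _ j hjK]
  obtain ⟨⟨i, hi⟩, s⟩ := v
  simp only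
  rcases i with _ | i
  · simp only [hn, if_true, lt_irrefl, if_false]; omega
  · have h1 := hj i
    rcases (show i + 1 < n ∨ i + 1 = n by omega) with h | h
    · simp only [h, if_true, Nat.succ_pos]; omega
    · rw [← h] at hjn
      simp only [h, lt_irrefl, if_false, hn, if_true]
      rw [← h]; omega

theorem theorem2 (r : ℕ) (hr : 1 < r) :
    (∀ α : ℝ, α ∈ Set.Ioo (1 : ℝ) (2 * (r : ℝ) - 1) → ∀ ε : ℝ, 0 < ε →
      ∃ (V : Type) (_ : Fintype V) (_ : DecidableEq V) (G : SimpleGraph V)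
        (_ : DecidableRel G.Adj),
        G.Connected ∧ DegreesIn G 2 (2 * r) ∧
          ∃ l : ℝ, IsLeadingEigenvalue (nonBacktrackingMatrix G) l ∧ |l - α| < ε) ∧
    closure (stronglyPeriodicGrowthRates r) = Set.Icc (1 : ℝ) (2 * (r : ℝ) - 1) := by
  classical
  have hdart : ∀ {V : Type} [Fintype V] {G : SimpleGraph V}, G.Connected → DegreesIn G 2 (2 * r) →
      Nonempty G.Dart := by
    intro V _ G hG hdeg
    obtain ⟨v⟩ := hG.nonempty
    have h := (hdeg.degree v).1
    rw [← SimpleGraph.card_neighborFinset_eq_degree] at h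
    obtain ⟨w, hw⟩ := Finset.card_pos.1 (by omega : 0 < (G.neighborFinset v).card)
    exact ⟨⟨(v, w), by simpa using hw⟩⟩
  refine ⟨fun α hα ε hε => ?_, ?_⟩
  · obtain ⟨V, _, G, l, U, hG, hdeg, hl, hlα, hU⟩ := exists_graph_near hα hε
    have := hdart hG hdeg
    exact ⟨V, inferInstance, inferInstance, G, inferInstance, hG, hdeg, l,
      hU.isLeadingEigenvalue (by positivity), hlα⟩
  · apply Set.Subset.antisymm
    · refine closure_minimal ?_ isClosed_Icc
      rintro g ⟨W, T, ⟨_, _, _, _, hT, _⟩, hdeg, hg⟩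
      have : T.LocallyFinite := fun v => (hdeg.finite_neighborSet v).fintype
      have := hg.mem_Icc hT (fun v => (hdeg.degree v).1) (fun v => (hdeg.degree v).2)
      simpa using this
    · have hr' : (1 : ℝ) ≠ 2 * (r : ℝ) - 1 := by
        have : (1 : ℝ) < r := by exact_mod_cast hr
        linarith
      rw [← closure_Ioo hr']
      refine closure_minimal (fun α hα => Metric.mem_closure_iff.2 fun ε hε => ?_) isClosed_closure
      obtain ⟨V, _, G, l, U, hG, hdeg, hl, hlα, hU⟩ := exists_graph_near hα hε
      have hne := hdart hG hdeg
      obtain ⟨o⟩ := hG.nonempty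
      have hcov := isUniversalCover_reducedWalkTree G o hG
      obtain ⟨hT, f, hf⟩ := hcov
      have hdegT := hf.degreesIn hdeg
      have : (reducedWalkTree G o).LocallyFinite := fun v =>
        (hdegT.finite_neighborSet v).fintype
      obtain ⟨e, he⟩ := Finite.exists_min fun e : G.Dart => l * U e.snd - U e.fst
      obtain ⟨e', he'⟩ := Finite.exists_max fun e : G.Dart => l * U e.snd - U e.fst
      refine ⟨l, ⟨_, reducedWalkTree G o,
        ⟨V, inferInstance, G, hG, isUniversalCover_reducedWalkTree G o hG⟩, hdegT, ?_⟩, ?_⟩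
      · exact (hU.comp_covering hf).hasGrowthRate hT
          (fun v => two_pos.trans_le (hdegT.degree v).1) hl.le (sub_pos.2 (hU.lt e.adj))
          (fun v w h => he ⟨(f v, f w), f.map_adj h⟩) (fun v w h => he' ⟨(f v, f w), f.map_adj h⟩)
      · rw [dist_comm, Real.dist_eq]; exact hlα
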